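/- Let $\mathbf{k}$ be a field and let $H$ be a finite-dimensional quasitriangular Hopf algebra over $\mathbf{k}$ with coproduct $\Delta$, counit $\varepsilon$, antipode $S$ and R-matrix $R=\sum R^{(1)}\otimes R^{(2)}\in H\otimes H$; that is, $R$ is invertible, $\Delta^{\mathrm{cop}}(h)R=R\Delta(h)$ for all $h\in H$, $(\Delta\otimes\mathrm{id})(R)=R_{13}R_{23}$ and $(\mathrm{id}\otimes\Delta)(R)=R_{13}R_{12}$. For left $H$-module algebras $A$, $B$ let $A\# B$ be the $H$-module $A\otimes B$ (diagonal action) with product $(a\# b)(c\# d)=\sum a(R^{(2)}.c)\#(R^{(1)}.b)d$, and let $\overline{A}$ be the $H$-module $A$ with product $a\circ b=\sum (R^{(2)}.b)(R^{(1)}.a)$. Let $H$ act on $\mathrm{End}(A)$ by $(h\cdot f)(m)=\sum h_{(1)}.f(S(h_{(2)}).m)$ and on $\mathrm{End}(A)^{op}$ by $(h\cdot f)(m)=\sum h_{(2)}.f(S^{-1}(h_{(1)}).m)$. A finite-dimensional left $H$-module algebra $A$ is called $(H,R)$-Azumaya if the $H$-module algebra maps $$F\colon A\#\overline{A}\to \mathrm{End}(A),\quad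 F(a\#\bar b)(c)=\sum a(R^{(2)}.c)(R^{(1)}.b),$$ $$G\colon \overline{A}\# A\to \mathrm{End}(A)^{op},\quad G(\bar a\# b)(c)=\sum (R^{(2)}.a)(R^{(1)}.c)b$$ are both isomorphisms. Then the dual Hopf algebra $H^*$, with its convolution product and the $H$-action $h\rightharpoonup f=\sum f_{(1)}\langle f_{(2)},h\rangle$, is $(H,R)$-Azumaya if and only if the map $$\theta\colon H^{*,op}\to H,\qquad \theta(f)=\sum R^{(1)}\langle f,R^{(2)}\rangle,$$ is an isomorphism of Hopf algebras. -/

import Mathlib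

open TensorProduct

noncomputable section

namespace QuasitriangularAzumaya

/-! ### Quasitriangular Hopf algebras -/

section RMatrix

variable (k : Type*) {H : Type*} [Field k] [Ring H] [HopfAlgebra k H]

/-- `R ↦ R₁₂ = ∑ R¹ ⊗ R² ⊗ 1`. -/
def leg12 : H ⊗[k] H →ₐ[k] H ⊗[k] (H ⊗[k] H) :=
  Algebra.TensorProduct.map (AlgHom.id k H) Algebra.TensorProduct.includeLeft

/-- `R ↦ R₁₃ = ∑ R¹ ⊗ 1 ⊗ R²`. -/
def leg13 : H ⊗[k] H →ₐ[k] H ⊗[k] (H ⊗[k] H) :=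
  Algebra.TensorProduct.map (AlgHom.id k H) Algebra.TensorProduct.includeRight

/-- `R ↦ R₂₃ = ∑ 1 ⊗ R¹ ⊗ R²`. -/
def leg23 : H ⊗[k] H →ₐ[k] H ⊗[k] (H ⊗[k] H) :=
  Algebra.TensorProduct.includeRight

variable {k}

/-- `R` is an R-matrix (a universal R-matrix, quasitriangular structure) for the Hopf algebra `H`:
it is invertible, `Δ^cop(h) R = R Δ(h)` for all `h`, `(Δ ⊗ id)(R) = R₁₃ R₂₃` and
`(id ⊗ Δ)(R) = R₁₃ R₁₂`. -/
structure IsRMatrix (R : H ⊗[k] H) : Prop where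
  isUnit : IsUnit R
  comm_comul_mul : ∀ h : H,
    TensorProduct.comm k H H (Coalgebra.comul h) * R = R * Coalgebra.comul h
  comul_left : TensorProduct.assoc k H H H ((Coalgebra.comul (R := k) (A := H)).rTensor H R) =
    leg13 k R * leg23 k R
  comul_right : (Coalgebra.comul (R := k) (A := H)).lTensor H R = leg13 k R * leg12 k R

variable (k H) in
/-- The inverse `S⁻¹` of the antipode, as the inverse in the ring of linear endomorphisms of `H`
(the antipode of a finite-dimensional Hopf algebra is bijective). -/
def antipodeInv : H →ₗ[k] H :=
  Ring.inverse (HopfAlgebra.antipode k : Module.End k H)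

end RMatrix

/-! ### Algebras in the category of `H`-modules -/

/-- The data of a multiplication, a unit and an `H`-action on a vector space. The laws of an
`H`-module algebra are collected in `PreModuleAlgebra.IsModuleAlgebra`. -/
structure PreModuleAlgebra (k H V : Type*) [Field k] [Ring H] [HopfAlgebra k H]
    [AddCommGroup V] [Module k V] where
  /-- the multiplication, `a ⊗ b ↦ a b` -/
  mul : V ⊗[k] V →ₗ[k] V
  /-- the unit -/
  one : V
  /-- the action, `h ↦ (a ↦ h . a)` -/
  act : H →ₗ[k] Module.End k V

namespace PreModuleAlgebra

variable {k H V W : Type*} [Field k] [Ring H] [HopfAlgebra k H]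
  [AddCommGroup V] [Module k V] [AddCommGroup W] [Module k W]

/-- The linear action of `H ⊗ H` on `V ⊗ W`: `(g ⊗ h) . (v ⊗ w) = g . v ⊗ h . w`. -/
def act₂ (X : PreModuleAlgebra k H V) (Y : PreModuleAlgebra k H W) :
    H ⊗[k] H →ₗ[k] Module.End k (V ⊗[k] W) :=
  TensorProduct.homTensorHomMap (RingHom.id k) V W V W ∘ₗ TensorProduct.map X.act Y.act

/-- The diagonal action of `H` on `V ⊗ W`: `h . (v ⊗ w) = ∑ h₁ . v ⊗ h₂ . w`. -/
def tensorAct (X : PreModuleAlgebra k H V) (Y : PreModuleAlgebra k H W) :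
    H →ₗ[k] Module.End k (V ⊗[k] W) :=
  X.act₂ Y ∘ₗ Coalgebra.comul

/-- The laws of an `H`-module algebra: an associative unital algebra which is an `H`-module such
that `h . (a b) = ∑ (h₁ . a) (h₂ . b)` and `h . 1 = ε(h) 1`. -/
structure IsModuleAlgebra (X : PreModuleAlgebra k H V) : Prop where
  mul_assoc : ∀ a b c : V, X.mul (X.mul (a ⊗ₜ b) ⊗ₜ c) = X.mul (a ⊗ₜ X.mul (b ⊗ₜ c))
  one_mul : ∀ a : V, X.mul (X.one ⊗ₜ a) = a
  mul_one : ∀ a : V, X.mul (a ⊗ₜ X.one) = a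
  one_act : X.act 1 = 1
  mul_act : ∀ g h : H, X.act (g * h) = X.act g * X.act h
  act_mul : ∀ (h : H) (x : V ⊗[k] V), X.act h (X.mul x) = X.mul (X.tensorAct X h x)
  act_one : ∀ h : H, X.act h X.one = Coalgebra.counit (R := k) h • X.one

/-- The linear map `φ` is an isomorphism of `H`-module algebras. -/
structure IsIso (X : PreModuleAlgebra k H V) (Y : PreModuleAlgebra k H W) (φ : V →ₗ[k] W) :
    Prop where
  bijective : Function.Bijective φ
  map_mul : ∀ a b : V, φ (X.mul (a ⊗ₜ b)) = Y.mul (φ a ⊗ₜ φ b)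
  map_one : φ X.one = Y.one
  map_act : ∀ (h : H) (a : V), φ (X.act h a) = Y.act h (φ a)

/-- The braiding `V ⊗ W → W ⊗ V`, `v ⊗ w ↦ ∑ R² . w ⊗ R¹ . v`. -/
def braiding (R : H ⊗[k] H) (X : PreModuleAlgebra k H V) (Y : PreModuleAlgebra k H W) :
    V ⊗[k] W →ₗ[k] W ⊗[k] V :=
  (TensorProduct.comm k V W).toLinearMap ∘ₗ X.act₂ Y R

/-- The opposite algebra of `A` in the category of `H`-modules: the same module with product
`a ∘ b = ∑ (R² . b) (R¹ . a)`. -/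
def opp (R : H ⊗[k] H) (X : PreModuleAlgebra k H V) : PreModuleAlgebra k H V where
  mul := X.mul ∘ₗ X.braiding R X
  one := X.one
  act := X.act

/-- The product `A # B` of algebras in the category of `H`-modules: the module `A ⊗ B` with
multiplication `(a # b) (c # d) = ∑ a (R² . c) # (R¹ . b) d`. -/
def smash (R : H ⊗[k] H) (X : PreModuleAlgebra k H V) (Y : PreModuleAlgebra k H W) :
    PreModuleAlgebra k H (V ⊗[k] W) where
  mul := TensorProduct.lift <| TensorProduct.lift <| LinearMap.mk₂ k
    (fun a b => TensorProduct.lift <| LinearMap.mk₂ k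
      (fun c d => TensorProduct.map
        (X.mul ∘ₗ TensorProduct.mk k V V a) (Y.mul ∘ₗ (TensorProduct.mk k W W).flip d)
        (Y.braiding R X (b ⊗ₜ c)))
      (by intros; simp [tmul_add]) (by intros; simp)
      (by intros; simp [TensorProduct.map_add_right, LinearMap.comp_add])
      (by intros; simp [TensorProduct.map_smul_right, LinearMap.comp_smul]))
    (by
      intros; ext
      simp [TensorProduct.map_add_left, LinearMap.comp_add])
    (by
      intros; ext
      simp [TensorProduct.map_smul_left, LinearMap.comp_smul])
    (by intros; ext; simp [add_tmul])
    (by intros; ext; simp [← smul_tmul'])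
  one := X.one ⊗ₜ Y.one
  act := X.tensorAct Y

variable (k V) in
/-- `p ⊗ q ↦ (f ↦ p ∘ f ∘ q)` on `End(V)`. -/
def sandwich : Module.End k V ⊗[k] Module.End k V →ₗ[k] Module.End k (Module.End k V) :=
  TensorProduct.lift <| LinearMap.mk₂ k (fun p q => LinearMap.mulLeftRight k (p, q))
    (by intros; ext; simp [add_mul]) (by intros; ext; simp)
    (by intros; ext; simp [mul_add]) (by intros; ext; simp)

/-- `End(V)` with composition and action `(h . f)(v) = ∑ h₁ . f(S(h₂) . v)`. -/
def endo (X : PreModuleAlgebra k H V) : PreModuleAlgebra k H (Module.End k V) where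
  mul := LinearMap.mul' k (Module.End k V)
  one := 1
  act := sandwich k V ∘ₗ
    TensorProduct.map X.act (X.act ∘ₗ HopfAlgebra.antipode k) ∘ₗ Coalgebra.comul

/-- `End(V)^op`, with the opposite of composition and action
`(h . f)(v) = ∑ h₂ . f(S⁻¹(h₁) . v)`. -/
def endoOp (X : PreModuleAlgebra k H V) : PreModuleAlgebra k H (Module.End k V) where
  mul := LinearMap.mul' k (Module.End k V) ∘ₗ
    (TensorProduct.comm k (Module.End k V) (Module.End k V)).toLinearMap
  one := 1
  act := sandwich k V ∘ₗ
    TensorProduct.map X.act (X.act ∘ₗ antipodeInv k H) ∘ₗ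
    (TensorProduct.comm k H H).toLinearMap ∘ₗ Coalgebra.comul

/-- `F(a # b)(c) = ∑ a (R² . c) (R¹ . b)`, from `A # Ā` to `End(A)`. -/
def azumayaF (R : H ⊗[k] H) (X : PreModuleAlgebra k H V) : V ⊗[k] V →ₗ[k] Module.End k V :=
  TensorProduct.lift <| LinearMap.mk₂ k
    (fun a b => X.mul ∘ₗ TensorProduct.mk k V V a ∘ₗ X.mul ∘ₗ X.braiding R X ∘ₗ
      TensorProduct.mk k V V b)
    (by intros; ext; simp) (by intros; ext; simp)
    (by intros; ext; simp [tmul_add]) (by intros; ext; simp)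

/-- `G(a # b)(c) = ∑ (R² . a) (R¹ . c) b`, from `Ā # A` to `End(A)^op`. -/
def azumayaG (R : H ⊗[k] H) (X : PreModuleAlgebra k H V) : V ⊗[k] V →ₗ[k] Module.End k V :=
  TensorProduct.lift <| LinearMap.mk₂ k
    (fun a b => X.mul ∘ₗ (TensorProduct.mk k V V).flip b ∘ₗ X.mul ∘ₗ X.braiding R X ∘ₗ
      (TensorProduct.mk k V V).flip a)
    (by intros; ext; simp) (by intros; ext; simp)
    (by intros; ext; simp) (by intros; ext; simp)

/-- `A` is an `(H, R)`-Azumaya algebra: a finite-dimensional `H`-module algebra for which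
`F : A # Ā → End(A)` and `G : Ā # A → End(A)^op` are isomorphisms of `H`-module algebras. -/
structure IsAzumaya (R : H ⊗[k] H) (X : PreModuleAlgebra k H V) : Prop where
  finite : Module.Finite k V
  isModuleAlgebra : X.IsModuleAlgebra
  isIso_F : IsIso (X.smash R (X.opp R)) X.endo (X.azumayaF R)
  isIso_G : IsIso ((X.opp R).smash R X) X.endoOp (X.azumayaG R)

end PreModuleAlgebra

/-! ### The dual Hopf algebra -/

section Dual

variable (k H : Type*) [Field k] [Ring H] [HopfAlgebra k H]

/-- The dual `H^*`, an algebra under convolution: `⟨f g, h⟩ = ∑ ⟨f, h₁⟩ ⟨g, h₂⟩`, with unit `ε`. -/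
abbrev HDual : Type _ := WithConv (Module.Dual k H)

variable {k H} in
/-- `θ : H^{*,op} → H`, `θ(f) = ∑ R¹ ⟨f, R²⟩`. -/
def theta (R : H ⊗[k] H) (f : (HDual k H)ᵐᵒᵖ) : H :=
  TensorProduct.rid k H ((MulOpposite.unop f).ofConv.lTensor H R)

variable [FiniteDimensional k H]

/-- The comultiplication `f ↦ ∑ f₁ ⊗ f₂` of `H^*`, determined by
`∑ ⟨f₁, x⟩ ⟨f₂, y⟩ = ⟨f, x y⟩`, and the counit `f ↦ ⟨f, 1⟩`. -/
instance : CoalgebraStruct k (HDual k H) where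
  comul := TensorProduct.map (WithConv.linearEquiv k (Module.Dual k H)).symm.toLinearMap
      (WithConv.linearEquiv k (Module.Dual k H)).symm.toLinearMap ∘ₗ
    (TensorProduct.dualDistribEquiv k H H).symm.toLinearMap ∘ₗ
    (LinearMap.mul' k H).dualMap ∘ₗ (WithConv.linearEquiv k (Module.Dual k H)).toLinearMap
  counit := Module.Dual.eval k H 1 ∘ₗ (WithConv.linearEquiv k (Module.Dual k H)).toLinearMap

/-- The action of `H` on `H^*`: `h ⇀ f = ∑ f₁ ⟨f₂, h⟩`. -/
def dualAct : H →ₗ[k] Module.End k (HDual k H) :=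
  LinearMap.mk₂ k
    (fun h f => TensorProduct.rid k (HDual k H)
      ((Module.Dual.eval k H h ∘ₗ
        (WithConv.linearEquiv k (Module.Dual k H)).toLinearMap).lTensor (HDual k H)
        (Coalgebra.comul f)))
    (by intros; simp [LinearMap.lTensor_add, LinearMap.add_comp])
    (by intros; simp [LinearMap.lTensor_smul, LinearMap.smul_comp])
    (by intros; simp) (by intros; simp)

/-- The algebra `H^*` with the action `h ⇀ f = ∑ f₁ ⟨f₂, h⟩` of `H`. -/
def dualModuleAlgebra : PreModuleAlgebra k H (HDual k H) where
  mul := LinearMap.mul' k (HDual k H)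
  one := 1
  act := dualAct k H

end Dual

end QuasitriangularAzumaya

end

/-! Write θᵗ(f) = ∑ ⟨f, R¹⟩ R² and b ∘ c = ∑ (R².c)(R¹.b). Identify H^* ⊗ H^* with Hom(H, H^*) by a
⊗ b ↦ (x ↦ a(x) b), and End(H^*) with End(H) by transposition. Since Δ^cop(h) R = R Δ(h), the
endomorphism of H dual to F(a # b) is x ↦ ∑ a(x₁) b(R¹ x₂) R² x₃. This is composition with θᵗ,
preceded and followed by a twist f ↦ (x ↦ ∑ f(x₁) . x₂) (`azumayaF_dual_eq`). The twists are
invertible, with S or S⁻¹ supplying the inverse, so F is bijective if and only if θᵗ is. In the same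
way G is governed by θ (`azumayaG_dual_eq`). In finite dimension θ and θᵗ are bijective together, so
each of F and G alone decides the matter.

Everything else holds without bijectivity. The map θ is always a bialgebra map (`thetaAlgHom`,
`map_thetaAlgHom_comul`), and a bialgebra isomorphism between Hopf algebras automatically respects
antipodes. For every H-module algebra, F(a # b)(c) = a (b ∘ c) and G(a # b)(c) = (c ∘ a) b; their
multiplicativity comes down to associativity of ∘, which is the Yang–Baxter equation
(`sum_act_mul_act_mul`). The inverse S⁻¹ exists because the Drinfeld element u is invertible and
satisfies u h = S²(h) u. -/

namespace QuasitriangularAzumaya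

/-! ### Sweedler sums along a fixed basis -/

section Sweedler

/-- A function of three variables that is linear in each of them. -/
structure IsTrilinear (k : Type*) {H M : Type*} [Field k] [AddCommGroup H] [Module k H]
    [AddCommGroup M] [Module k M] (φ : H → H → H → M) : Prop where
  left : ∀ y z, IsLinearMap k fun x => φ x y z
  mid : ∀ x z, IsLinearMap k fun y => φ x y z
  right : ∀ x y, IsLinearMap k fun z => φ x y z

/-- Makes Sweedler calculus available: applying the lift to both sides of an identity in H ⊗ H ⊗ H
gives a substitution rule for every trilinear expression. -/
theorem IsTrilinear.exists_lift {k H M : Type*} [Field k] [AddCommGroup H] [Module k H]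
    [AddCommGroup M] [Module k M] {φ : H → H → H → M} (hφ : IsTrilinear k φ) :
    ∃ Φ : H ⊗[k] (H ⊗[k] H) →ₗ[k] M, ∀ x y z, Φ (x ⊗ₜ (y ⊗ₜ z)) = φ x y z := by
  let ψ : H →ₗ[k] H ⊗[k] H →ₗ[k] M :=
    { toFun := fun x => TensorProduct.lift (LinearMap.mk₂ k (φ x)
        (fun _ _ z => (hφ.mid x z).map_add _ _) (fun _ _ z => (hφ.mid x z).map_smul _ _)
        (fun y _ _ => (hφ.right x y).map_add _ _) (fun _ y _ => (hφ.right x y).map_smul _ _))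
      map_add' := fun x x' => by
        ext y z
        exact (hφ.left y z).map_add x x'
      map_smul' := fun c x => by
        ext y z
        exact (hφ.left y z).map_smul c x }
  exact ⟨TensorProduct.lift ψ, fun x y z => rfl⟩

theorem exists_lift_of_isLinearMap {k H M : Type*} [Field k] [AddCommGroup H] [Module k H]
    [AddCommGroup M] [Module k M] {φ : H → H → M} (h₁ : ∀ y, IsLinearMap k fun x => φ x y)
    (h₂ : ∀ x, IsLinearMap k fun y => φ x y) :
    ∃ Φ : H ⊗[k] H →ₗ[k] M, ∀ x y, Φ (x ⊗ₜ y) = φ x y :=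
  ⟨TensorProduct.lift (LinearMap.mk₂ k φ (fun _ _ z => (h₁ z).map_add _ _)
    (fun _ _ z => (h₁ z).map_smul _ _) (fun y _ _ => (h₂ y).map_add _ _)
    (fun _ y _ => (h₂ y).map_smul _ _)), fun _ _ => rfl⟩

variable {k H M : Type*} [Field k] [Ring H] [HopfAlgebra k H] [FiniteDimensional k H]
  [AddCommGroup M] [Module k M]

variable (k H) in
/-- The vectors of a fixed basis of `H`. -/
noncomputable def basisVec (i : Fin (Module.finrank k H)) : H := Module.finBasis k H i

/-- The left coefficients of an element of `H ⊗ H` along the fixed basis of the right factor. -/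
noncomputable def coeff (i : Fin (Module.finrank k H)) : H ⊗[k] H →ₗ[k] H :=
  (TensorProduct.rid k H).toLinearMap ∘ₗ ((Module.finBasis k H).coord i).lTensor H

/-- The left coefficients of the comultiplication. -/
noncomputable def comulCoeff (i : Fin (Module.finrank k H)) : H →ₗ[k] H :=
  coeff i ∘ₗ Coalgebra.comul

local notation "𝐞" => basisVec k H
local notation "δ" => comulCoeff (k := k) (H := H)

/-- On a pure tensor this is the basis expansion of the right factor. Below, `coeff i R` and `𝐞 i`
play the roles of R¹ and R², and `δ i h` and `𝐞 i` those of h₁ and h₂. -/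
theorem sum_coeff_tmul (z : H ⊗[k] H) : ∑ i, coeff i z ⊗ₜ[k] 𝐞 i = z := by
  induction z with
  | zero => simp
  | add x y hx hy => simp only [map_add, add_tmul, Finset.sum_add_distrib, hx, hy]
  | tmul x y =>
    simp only [coeff, LinearMap.comp_apply, LinearMap.lTensor_tmul, LinearEquiv.coe_coe,
      TensorProduct.rid_tmul, smul_tmul, ← tmul_sum, basisVec, Module.Basis.coord_apply]
    rw [(Module.finBasis k H).sum_repr]

theorem comul_eq_sum (h : H) : Coalgebra.comul (R := k) h = ∑ i, δ i h ⊗ₜ[k] 𝐞 i :=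
  (sum_coeff_tmul _).symm

theorem sum_coassoc (h : H) {φ : H → H → H → M} (hφ : IsTrilinear k φ) :
    ∑ i, ∑ j, φ (δ j (δ i h)) (𝐞 j) (𝐞 i) = ∑ i, ∑ j, φ (δ i h) (δ j (𝐞 i)) (𝐞 j) := by
  obtain ⟨Φ, hΦ⟩ := hφ.exists_lift
  have := congrArg Φ (Coalgebra.coassoc_apply (R := k) h)
  simpa only [comul_eq_sum, map_sum, LinearMap.rTensor_tmul, LinearMap.lTensor_tmul, sum_tmul,
    tmul_sum, TensorProduct.assoc_tmul, hΦ] using this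

theorem sum_counit_smul_basisVec (h : H) :
    ∑ i, Coalgebra.counit (R := k) (δ i h) • 𝐞 i = h := by
  have := congrArg (TensorProduct.lid k H) (Coalgebra.rTensor_counit_comul (R := k) h)
  simpa only [comul_eq_sum, map_sum, LinearMap.rTensor_tmul, TensorProduct.lid_tmul, one_smul]
    using this

theorem sum_counit_basisVec_smul (h : H) :
    ∑ i, Coalgebra.counit (R := k) (𝐞 i) • δ i h = h := by
  have := congrArg (TensorProduct.rid k H) (Coalgebra.lTensor_counit_comul (R := k) h)
  simpa only [comul_eq_sum, map_sum, LinearMap.lTensor_tmul, TensorProduct.rid_tmul, one_smul]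
    using this

local notation "ε" => Coalgebra.counit (R := k) (A := H)
local notation "S" => HopfAlgebra.antipode k (A := H)

theorem sum_antipode_mul (h : H) : ∑ i, S (δ i h) * 𝐞 i = ε h • (1 : H) := by
  simpa [comul_eq_sum, Algebra.algebraMap_eq_smul_one] using
    HopfAlgebra.mul_antipode_rTensor_comul_apply (R := k) h

theorem sum_mul_antipode (h : H) : ∑ i, δ i h * S (𝐞 i) = ε h • (1 : H) := by
  simpa [comul_eq_sum, Algebra.algebraMap_eq_smul_one] using
    HopfAlgebra.mul_antipode_lTensor_comul_apply (R := k) h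

theorem sum_comul_mul (g h : H) {φ : H → H → M} (h₁ : ∀ y, IsLinearMap k fun x => φ x y)
    (h₂ : ∀ x, IsLinearMap k fun y => φ x y) :
    ∑ i, φ (δ i (g * h)) (𝐞 i) = ∑ i, ∑ j, φ (δ i g * δ j h) (𝐞 i * 𝐞 j) := by
  obtain ⟨Φ, hΦ⟩ := exists_lift_of_isLinearMap h₁ h₂
  have := congrArg Φ (Bialgebra.comul_mul (R := k) (A := H) g h)
  simpa only [comul_eq_sum, map_sum, Finset.sum_mul_sum, Algebra.TensorProduct.tmul_mul_tmul, hΦ]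
    using this

end Sweedler

/-! ### Identities for the R-matrix -/

section RMatrixIdentities

variable {k H M : Type*} [Field k] [Ring H] [HopfAlgebra k H] [FiniteDimensional k H]
  [AddCommGroup M] [Module k M] {R : H ⊗[k] H}

local notation "𝐞" => basisVec k H
local notation "δ" => comulCoeff (k := k) (H := H)
local notation "ε" => Coalgebra.counit (R := k) (A := H)
local notation "S" => HopfAlgebra.antipode k (A := H)

namespace IsRMatrix

theorem sum_comul_left (hR : IsRMatrix R) {φ : H → H → H → M} (hφ : IsTrilinear k φ) :
    ∑ i, ∑ j, φ (δ j (coeff i R)) (𝐞 j) (𝐞 i) =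
      ∑ i, ∑ j, φ (coeff i R) (coeff j R) (𝐞 i * 𝐞 j) := by
  obtain ⟨Φ, hΦ⟩ := hφ.exists_lift
  have := congrArg Φ hR.comul_left
  conv at this =>
    enter [1, 2, 2]
    rw [← sum_coeff_tmul R]
  conv at this =>
    enter [2]
    rw [← sum_coeff_tmul R]
  simpa [leg13, leg23, comul_eq_sum, sum_tmul, Finset.sum_mul_sum, hΦ] using this

theorem sum_comul_right (hR : IsRMatrix R) {φ : H → H → H → M} (hφ : IsTrilinear k φ) :
    ∑ i, ∑ j, φ (coeff i R) (δ j (𝐞 i)) (𝐞 j) =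
      ∑ i, ∑ j, φ (coeff i R * coeff j R) (𝐞 j) (𝐞 i) := by
  obtain ⟨Φ, hΦ⟩ := hφ.exists_lift
  have := congrArg Φ hR.comul_right
  conv at this =>
    enter [1, 2, 2]
    rw [← sum_coeff_tmul R]
  conv at this =>
    enter [2]
    rw [← sum_coeff_tmul R]
  simpa [leg13, leg12, comul_eq_sum, tmul_sum, Finset.sum_mul_sum, hΦ] using this

theorem sum_comul_comm (hR : IsRMatrix R) (h : H) {φ : H → H → M}
    (h₁ : ∀ y, IsLinearMap k fun x => φ x y) (h₂ : ∀ x, IsLinearMap k fun y => φ x y) :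
    ∑ i, ∑ j, φ (𝐞 i * coeff j R) (δ i h * 𝐞 j) =
      ∑ i, ∑ j, φ (coeff i R * δ j h) (𝐞 i * 𝐞 j) := by
  obtain ⟨Φ, hΦ⟩ := exists_lift_of_isLinearMap h₁ h₂
  have := congrArg Φ (hR.comm_comul_mul h)
  rw [← sum_coeff_tmul R, comul_eq_sum] at this
  simpa only [map_sum, Finset.sum_mul_sum, TensorProduct.comm_tmul,
    Algebra.TensorProduct.tmul_mul_tmul, hΦ] using this

/-- This is R₁₂R₁₃R₂₃ = R₂₃R₁₃R₁₂. The product R₁₃R₂₃ is (Δ ⊗ id)(R), and moving R₁₂ across it turns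
Δ into Δ^cop. -/
theorem yangBaxter (hR : IsRMatrix R) {φ : H → H → H → M} (hφ : IsTrilinear k φ) :
    ∑ i, ∑ j, ∑ l, φ (coeff i R * coeff j R) (𝐞 i * coeff l R) (𝐞 j * 𝐞 l) =
      ∑ i, ∑ j, ∑ l, φ (coeff j R * coeff l R) (coeff i R * 𝐞 l) (𝐞 i * 𝐞 j) := by
  have lin (i) : IsTrilinear k fun x y z => φ (coeff i R * x) (𝐞 i * y) z := by
    constructor <;> intros <;> constructor <;> intros <;>
      simp [mul_add, (hφ.left _ _).map_add, (hφ.left _ _).map_smul, (hφ.mid _ _).map_add,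
        (hφ.mid _ _).map_smul, (hφ.right _ _).map_add, (hφ.right _ _).map_smul]
  -- The first two arguments are exchanged because this form is fed (Δ ⊗ id)(R) where (Δ^cop ⊗
  -- id)(R) is wanted.
  have lin' (i) : IsTrilinear k fun y x z => φ (x * coeff i R) (y * 𝐞 i) z := by
    constructor <;> intros <;> constructor <;> intros <;>
      simp [add_mul, (hφ.left _ _).map_add, (hφ.left _ _).map_smul, (hφ.mid _ _).map_add,
        (hφ.mid _ _).map_smul, (hφ.right _ _).map_add, (hφ.right _ _).map_smul]
  calc
    _ = ∑ i, ∑ l, ∑ j, φ (coeff i R * δ j (coeff l R)) (𝐞 i * 𝐞 j) (𝐞 l) :=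
      Finset.sum_congr rfl fun i _ => (hR.sum_comul_left (lin i)).symm
    _ = ∑ l, ∑ i, ∑ j, φ (coeff i R * δ j (coeff l R)) (𝐞 i * 𝐞 j) (𝐞 l) := Finset.sum_comm
    _ = ∑ l, ∑ i, ∑ j, φ (𝐞 i * coeff j R) (δ i (coeff l R) * 𝐞 j) (𝐞 l) :=
      Finset.sum_congr rfl fun l _ => (hR.sum_comul_comm (coeff l R)
        (φ := fun x y => φ x y (𝐞 l)) (fun y => hφ.left y _) (fun x => hφ.mid x _)).symm
    _ = ∑ l, ∑ j, ∑ i, φ (𝐞 i * coeff j R) (δ i (coeff l R) * 𝐞 j) (𝐞 l) :=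
      Finset.sum_congr rfl fun l _ => Finset.sum_comm
    _ = ∑ j, ∑ l, ∑ i, φ (𝐞 i * coeff j R) (δ i (coeff l R) * 𝐞 j) (𝐞 l) := Finset.sum_comm
    _ = ∑ l, ∑ i, ∑ j, φ (coeff j R * coeff l R) (coeff i R * 𝐞 l) (𝐞 i * 𝐞 j) :=
      Finset.sum_congr rfl fun l _ => hR.sum_comul_left (lin' l)
    _ = ∑ i, ∑ l, ∑ j, φ (coeff j R * coeff l R) (coeff i R * 𝐞 l) (𝐞 i * 𝐞 j) :=
      Finset.sum_comm
    _ = _ := Finset.sum_congr rfl fun i _ => Finset.sum_comm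

/-- Applying ε to the first leg of (Δ ⊗ id)(R) = R₁₃R₂₃ gives R = (1 ⊗ (ε ⊗ id)(R)) R, and the unit
R cancels. -/
theorem sum_counit_coeff (hR : IsRMatrix R) : ∑ i, ε (coeff i R) • 𝐞 i = 1 := by
  have h := hR.sum_comul_left (φ := fun x y z => ε x • (y ⊗ₜ[k] z)) (by
    constructor <;> intros <;> constructor <;> intros <;>
      simp [add_smul, tmul_add, add_tmul, smul_tmul', mul_smul, smul_comm (ε _)])
  have h₁ : (∑ i, ∑ j, ε (δ j (coeff i R)) • (𝐞 j ⊗ₜ[k] 𝐞 i)) = R := by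
    simp only [smul_tmul', ← sum_tmul, sum_counit_smul_basisVec, sum_coeff_tmul]
  have h₂ : (∑ i, ∑ j, ε (coeff i R) • (coeff j R ⊗ₜ[k] (𝐞 i * 𝐞 j))) =
      ((1 : H) ⊗ₜ[k] ∑ i, ε (coeff i R) • 𝐞 i) * R := by
    conv_rhs => enter [2]; rw [← sum_coeff_tmul R]
    simp only [tmul_sum, Finset.sum_mul_sum, Algebra.TensorProduct.tmul_mul_tmul,
      one_mul, smul_mul_assoc, tmul_smul]
  rw [h₁, h₂] at h
  have h₃ : (1 : H) ⊗ₜ[k] (∑ i, ε (coeff i R) • 𝐞 i) = (1 : H) ⊗ₜ[k] (1 : H) := by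
    apply hR.isUnit.mul_right_cancel
    rw [← h, ← Algebra.TensorProduct.one_def, one_mul]
  simpa using congrArg (TensorProduct.lid k H ∘ (Coalgebra.counit (R := k) (A := H)).rTensor H) h₃

theorem sum_counit_basisVec (hR : IsRMatrix R) : ∑ i, ε (𝐞 i) • coeff i R = 1 := by
  have h := hR.sum_comul_right (φ := fun x y z => ε z • (x ⊗ₜ[k] y)) (by
    constructor <;> intros <;> constructor <;> intros <;>
      simp [add_smul, tmul_add, add_tmul, smul_tmul', mul_smul, smul_comm (ε _)])
  have h₁ : (∑ i, ∑ j, ε (𝐞 j) • (coeff i R ⊗ₜ[k] δ j (𝐞 i))) = R := by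
    simp only [← tmul_smul, ← tmul_sum, sum_counit_basisVec_smul, sum_coeff_tmul]
  have h₂ : (∑ i, ∑ j, ε (𝐞 i) • ((coeff i R * coeff j R) ⊗ₜ[k] 𝐞 j)) =
      ((∑ i, ε (𝐞 i) • coeff i R) ⊗ₜ[k] (1 : H)) * R := by
    conv_rhs => enter [2]; rw [← sum_coeff_tmul R]
    simp only [sum_tmul, Finset.sum_mul_sum, Algebra.TensorProduct.tmul_mul_tmul,
      one_mul, smul_mul_assoc, smul_tmul']
  rw [h₁, h₂] at h
  have h₃ : (∑ i, ε (𝐞 i) • coeff i R) ⊗ₜ[k] (1 : H) = (1 : H) ⊗ₜ[k] (1 : H) := by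
    apply hR.isUnit.mul_right_cancel
    rw [← h, ← Algebra.TensorProduct.one_def, one_mul]
  simpa using congrArg (TensorProduct.rid k H ∘ (Coalgebra.counit (R := k) (A := H)).lTensor H) h₃

/-- Apply S to the first leg of (Δ ⊗ id)(R) = R₁₃R₂₃ and multiply the first two legs together. -/
theorem antipode_left_mul_self (hR : IsRMatrix R) :
    (∑ i, S (coeff i R) ⊗ₜ[k] 𝐞 i) * R = 1 := by
  have h := hR.sum_comul_left (φ := fun x y z => (S x * y) ⊗ₜ[k] z) (by
    constructor <;> intros <;> constructor <;> intros <;>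
      simp [tmul_add, add_tmul, smul_tmul', mul_add, add_mul])
  conv_lhs => enter [2]; rw [← sum_coeff_tmul R]
  simp only [Finset.sum_mul_sum, Algebra.TensorProduct.tmul_mul_tmul, ← h, ← sum_tmul,
    sum_antipode_mul]
  simp only [smul_tmul, ← tmul_sum, hR.sum_counit_coeff, Algebra.TensorProduct.one_def]

theorem mul_antipode_left (hR : IsRMatrix R) :
    R * (∑ i, S (coeff i R) ⊗ₜ[k] 𝐞 i) = 1 := by
  apply hR.isUnit.mul_right_cancel
  rw [mul_assoc, hR.antipode_left_mul_self, mul_one, one_mul]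

/-- Both R and (S ⊗ S)(R) are inverse to (S ⊗ id)(R), on the left and on the right respectively; the
second comes from (id ⊗ Δ)(R) = R₁₃R₁₂. -/
theorem antipode_tmul_antipode (hR : IsRMatrix R) :
    ∑ i, S (coeff i R) ⊗ₜ[k] S (𝐞 i) = R := by
  have h := hR.sum_comul_right (φ := fun x y z => S x ⊗ₜ[k] (y * S z)) (by
    constructor <;> intros <;> constructor <;> intros <;>
      simp [tmul_add, add_tmul, smul_tmul', mul_add, add_mul])
  refine (left_inv_eq_right_inv hR.mul_antipode_left ?_).symm
  simp only [Finset.sum_mul_sum, Algebra.TensorProduct.tmul_mul_tmul,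
    ← HopfAlgebra.antipode_mul_antidistrib]
  rw [Finset.sum_comm, ← h]
  simp only [← tmul_sum, sum_mul_antipode]
  have h₁ : ∑ i, ε (𝐞 i) • S (coeff i R) = 1 := by
    simpa using congrArg S hR.sum_counit_basisVec
  simp only [tmul_smul, smul_tmul', ← sum_tmul, h₁, Algebra.TensorProduct.one_def]

end IsRMatrix

/-- The Drinfeld element `∑ S(R²) R¹`. -/
noncomputable def drinfeldElement (R : H ⊗[k] H) : H := ∑ i, S (𝐞 i) * coeff i R

namespace IsRMatrix

/-- With u = ∑ S(R²) R¹, insert S²(h₃) S(h₂) = S(h₂ S(h₃)) to get u h = ∑ S²(h₃) S(R² h₂) R¹ h₁.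
Commuting R past Δ turns this into ∑ S²(h₃) S(R²) S(h₁) h₂ R¹, where S(h₁) h₂ collapses. -/
theorem drinfeldElement_mul (hR : IsRMatrix R) (h : H) :
    drinfeldElement R * h = S (S h) * drinfeldElement R := by
  have h₁ : ∑ l, ∑ i, ∑ j, S (S (𝐞 l)) * (S (𝐞 i * 𝐞 j) * (coeff i R * δ j (δ l h))) =
      ∑ l, ∑ i, ∑ j, S (S (𝐞 l)) * (S (δ i (δ l h) * 𝐞 j) * (𝐞 i * coeff j R)) := by
    refine Finset.sum_congr rfl fun l _ => (hR.sum_comul_comm (δ l h)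
      (φ := fun x y => S (S (𝐞 l)) * (S y * x)) ?_ ?_).symm <;> intros <;> constructor <;> intros <;>
        simp [mul_add, add_mul]
  have h₂ := sum_coassoc (k := k) h
    (φ := fun x y z => S (S z) * (S y * (drinfeldElement R * x))) (by
      constructor <;> intros <;> constructor <;> intros <;> simp [mul_add, add_mul])
  have h₃ : ∑ l, ∑ i, ∑ j, S (S (𝐞 l)) * (S (𝐞 i * 𝐞 j) * (coeff i R * δ j (δ l h))) =
      ∑ l, ∑ j, S (S (𝐞 l)) * (S (𝐞 j) * (drinfeldElement R * δ j (δ l h))) := by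
    refine Finset.sum_congr rfl fun l _ => ?_
    rw [Finset.sum_comm]
    refine Finset.sum_congr rfl fun j _ => ?_
    simp only [drinfeldElement, Finset.sum_mul, Finset.mul_sum,
      HopfAlgebra.antipode_mul_antidistrib, mul_assoc]
  have h₄ : ∑ l, ∑ j, S (S (𝐞 j)) * (S (δ j (𝐞 l)) * (drinfeldElement R * δ l h)) =
      drinfeldElement R * h := by
    simp only [← mul_assoc, ← HopfAlgebra.antipode_mul_antidistrib, ← Finset.sum_mul, ← map_sum,
      sum_mul_antipode]
    simp only [map_smul, HopfAlgebra.antipode_one, smul_mul_assoc, one_mul, ← mul_smul_comm,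
      ← Finset.mul_sum, sum_counit_basisVec_smul]
  have h₅ : ∑ l, ∑ i, ∑ j, S (S (𝐞 l)) * (S (δ i (δ l h) * 𝐞 j) * (𝐞 i * coeff j R)) =
      S (S h) * drinfeldElement R := by
    have h₆ (l) : ∑ i, ∑ j, S (S (𝐞 l)) * (S (δ i (δ l h) * 𝐞 j) * (𝐞 i * coeff j R)) =
        ε (δ l h) • (S (S (𝐞 l)) * drinfeldElement R) := by
      rw [Finset.sum_comm, drinfeldElement, Finset.mul_sum, Finset.smul_sum]
      refine Finset.sum_congr rfl fun j _ => ?_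
      have := congrArg (fun x => S (S (𝐞 l)) * (S (𝐞 j) * (x * coeff j R)))
        (sum_antipode_mul (k := k) (δ l h))
      simpa [HopfAlgebra.antipode_mul_antidistrib, Finset.sum_mul, Finset.mul_sum, mul_assoc]
        using this
    simp only [h₆, ← smul_mul_assoc, ← Finset.sum_mul, ← map_smul, ← map_sum,
      sum_counit_smul_basisVec]
  rw [← h₄, ← h₂, ← h₃, h₁, h₅]

/-- Moving u to the right of R² produces S²(R²) u S²(R¹). Replacing (S ⊗ S)(R) by R leaves the image
of R · (S ⊗ id)(R) = 1 under x ⊗ y ↦ S(y) x. -/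
theorem drinfeldElement_mul_eq_one (hR : IsRMatrix R) :
    drinfeldElement R * ∑ i, 𝐞 i * S (S (coeff i R)) = 1 := by
  obtain ⟨Φ, hΦ⟩ := exists_lift_of_isLinearMap (k := k) (H := H)
    (φ := fun x y => ∑ j, S (𝐞 j * y) * (coeff j R * S x))
    (by intros; constructor <;> intros <;> simp [mul_add, Finset.sum_add_distrib, Finset.smul_sum])
    (by intros; constructor <;> intros <;>
      simp [mul_add, add_mul, Finset.sum_add_distrib, Finset.smul_sum])
  obtain ⟨Ψ, hΨ⟩ := exists_lift_of_isLinearMap (k := k) (H := H)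
    (φ := fun x y => S y * x)
    (by intros; constructor <;> intros <;> simp [mul_add])
    (by intros; constructor <;> intros <;> simp [add_mul])
  have h₁ := congrArg Φ (hR.antipode_tmul_antipode.trans (sum_coeff_tmul R).symm)
  have h₂ := congrArg Ψ hR.mul_antipode_left
  conv at h₂ => enter [1, 2, 1]; rw [← sum_coeff_tmul R]
  simp only [Finset.sum_mul_sum, map_sum, Algebra.TensorProduct.tmul_mul_tmul, hΦ, hΨ,
    Algebra.TensorProduct.one_def, HopfAlgebra.antipode_one, one_mul] at h₁ h₂
  rw [← h₂, Finset.sum_comm, ← h₁, Finset.mul_sum]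
  refine Finset.sum_congr rfl fun i _ => ?_
  rw [← mul_assoc, hR.drinfeldElement_mul]
  simp only [drinfeldElement, Finset.sum_mul, Finset.mul_sum,
      HopfAlgebra.antipode_mul_antidistrib, mul_assoc]

theorem antipode_bijective (hR : IsRMatrix R) : Function.Bijective S := by
  have hinj : Function.Injective S := by
    rw [injective_iff_map_eq_zero]
    intro h hh
    have := hR.drinfeldElement_mul h
    rw [hh, map_zero, zero_mul] at this
    -- Only a right inverse of u is known; as an operator on the finite-dimensional space H it is
    -- two-sided, so u h = 0 forces h = 0.
    have hu : LinearMap.mulLeft k (drinfeldElement R) *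
        LinearMap.mulLeft k (∑ i, 𝐞 i * S (S (coeff i R))) = 1 := by
      rw [Module.End.mul_eq_comp, ← LinearMap.mulLeft_mul, hR.drinfeldElement_mul_eq_one]
      exact LinearMap.mulLeft_one ..
    rw [mul_eq_one_comm] at hu
    simpa [this] using (LinearMap.congr_fun hu h).symm
  exact ⟨hinj, LinearMap.surjective_of_injective hinj⟩

theorem antipode_antipodeInv (hR : IsRMatrix R) (h : H) : S (antipodeInv k H h) = h :=
  LinearMap.congr_fun (Ring.mul_inverse_cancel _
    ((Module.End.isUnit_iff S).mpr hR.antipode_bijective)) h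

theorem sum_antipodeInv_mul (hR : IsRMatrix R) (h : H) :
    ∑ i, antipodeInv k H (𝐞 i) * δ i h = ε h • (1 : H) := by
  apply hR.antipode_bijective.1
  simp [HopfAlgebra.antipode_mul_antidistrib, hR.antipode_antipodeInv, sum_antipode_mul]

theorem sum_mul_antipodeInv (hR : IsRMatrix R) (h : H) :
    ∑ i, 𝐞 i * antipodeInv k H (δ i h) = ε h • (1 : H) := by
  apply hR.antipode_bijective.1
  simp [HopfAlgebra.antipode_mul_antidistrib, hR.antipode_antipodeInv, sum_mul_antipode]

end IsRMatrix

end RMatrixIdentities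

/-! ### The maps `F` and `G` of a module algebra -/

section ModuleAlgebra

variable {k H : Type*} [Field k] [Ring H] [HopfAlgebra k H] [FiniteDimensional k H]
  {R : H ⊗[k] H}

local notation "𝐞" => basisVec k H
local notation "δ" => comulCoeff (k := k) (H := H)
local notation "ε" => Coalgebra.counit (R := k) (A := H)
local notation "S" => HopfAlgebra.antipode k (A := H)

namespace PreModuleAlgebra

section General

variable {V W : Type*} [AddCommGroup V] [Module k V] [AddCommGroup W] [Module k W]

theorem braiding_tmul (X : PreModuleAlgebra k H V) (Y : PreModuleAlgebra k H W) (v : V) (w : W) :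
    braiding R X Y (v ⊗ₜ w) = ∑ i, Y.act (𝐞 i) w ⊗ₜ X.act (coeff i R) v := by
  conv_lhs => rw [← sum_coeff_tmul R]
  simp [braiding, act₂]

theorem tensorAct_tmul (X : PreModuleAlgebra k H V) (Y : PreModuleAlgebra k H W) (h : H) (v : V)
    (w : W) : X.tensorAct Y h (v ⊗ₜ w) = ∑ i, X.act (δ i h) v ⊗ₜ Y.act (𝐞 i) w := by
  simp [tensorAct, act₂, comul_eq_sum, LinearMap.sum_apply]

theorem smash_mul_tmul (X : PreModuleAlgebra k H V) (Y : PreModuleAlgebra k H W) (a c : V)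
    (b d : W) : (smash R X Y).mul ((a ⊗ₜ b) ⊗ₜ (c ⊗ₜ d)) =
      ∑ i, X.mul (a ⊗ₜ X.act (𝐞 i) c) ⊗ₜ Y.mul (Y.act (coeff i R) b ⊗ₜ d) := by
  simp [smash, braiding_tmul]

theorem endo_act_apply (X : PreModuleAlgebra k H V) (h : H) (f : Module.End k V) (v : V) :
    X.endo.act h f v = ∑ i, X.act (δ i h) (f (X.act (S (𝐞 i)) v)) := by
  simp [endo, sandwich, comul_eq_sum, LinearMap.sum_apply]

theorem endoOp_act_apply (X : PreModuleAlgebra k H V) (h : H) (f : Module.End k V) (v : V) :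
    X.endoOp.act h f v = ∑ i, X.act (𝐞 i) (f (X.act (antipodeInv k H (δ i h)) v)) := by
  simp [endoOp, sandwich, comul_eq_sum, LinearMap.sum_apply]

end General

variable {A : Type*} [Ring A] [Algebra k A]

/-- An algebra with an action of `H` by linear endomorphisms. -/
noncomputable def ofAlgHom (ρ : H →ₐ[k] Module.End k A) : PreModuleAlgebra k H A where
  mul := LinearMap.mul' k A
  one := 1
  act := ρ.toLinearMap

variable (ρ : H →ₐ[k] Module.End k A)

omit [FiniteDimensional k H] in
@[simp] theorem ofAlgHom_mul (a b : A) : (ofAlgHom ρ).mul (a ⊗ₜ b) = a * b := rfl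
omit [FiniteDimensional k H] in
@[simp] theorem ofAlgHom_one : (ofAlgHom ρ).one = 1 := rfl
omit [FiniteDimensional k H] in
@[simp] theorem ofAlgHom_act (h : H) : (ofAlgHom ρ).act h = ρ h := rfl
omit [FiniteDimensional k H] in
@[simp] theorem opp_act (h : H) : ((ofAlgHom ρ).opp R).act h = ρ h := rfl

theorem opp_mul (a b : A) : ((ofAlgHom ρ).opp R).mul (a ⊗ₜ b) =
    ∑ i, ρ (𝐞 i) b * ρ (coeff i R) a := by
  simp [opp, braiding_tmul]

theorem azumayaF_tmul (a b c : A) : (ofAlgHom ρ).azumayaF R (a ⊗ₜ b) c =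
    ∑ i, a * (ρ (𝐞 i) c * ρ (coeff i R) b) := by
  simp [azumayaF, braiding_tmul]

theorem azumayaG_tmul (a b c : A) : (ofAlgHom ρ).azumayaG R (a ⊗ₜ b) c =
    ∑ i, ρ (𝐞 i) a * ρ (coeff i R) c * b := by
  simp [azumayaG, braiding_tmul]

variable {ρ}

theorem isModuleAlgebra_ofAlgHom
    (act_mul : ∀ h a b, ρ h (a * b) = ∑ i, ρ (δ i h) a * ρ (𝐞 i) b)
    (act_one : ∀ h, ρ h 1 = ε h • 1) : (ofAlgHom ρ).IsModuleAlgebra where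
  mul_assoc := by simp [mul_assoc]
  one_mul := by simp
  mul_one := by simp
  one_act := by simp
  mul_act := by simp
  act_mul h x := by
    induction x with
    | zero => simp
    | add x y hx hy => simp only [map_add, hx, hy]
    | tmul a b => simp [tensorAct_tmul, act_mul]
  act_one := act_one

theorem IsModuleAlgebra.act_mul_eq (hX : (ofAlgHom ρ).IsModuleAlgebra) (h : H) (a b : A) :
    ρ h (a * b) = ∑ i, ρ (δ i h) a * ρ (𝐞 i) b := by
  simpa [tensorAct_tmul] using hX.act_mul h (a ⊗ₜ b)

omit [FiniteDimensional k H] in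
theorem act_act (ρ : H →ₐ[k] Module.End k A) (g h : H) (a : A) :
    ρ g (ρ h a) = ρ (g * h) a := by
  simp

/-- A hexagon identity: braiding past a product is braiding past each factor, by (Δ ⊗ id)(R) =
R₁₃R₂₃. -/
theorem sum_mul_act_mul (hR : IsRMatrix R) (hX : (ofAlgHom ρ).IsModuleAlgebra) (x y m : A) :
    ∑ l, ρ (𝐞 l) m * ρ (coeff l R) (x * y) =
      ∑ i, ∑ j, ρ (𝐞 i * 𝐞 j) m * (ρ (coeff i R) x * ρ (coeff j R) y) := by
  rw [← hR.sum_comul_left (φ := fun x' y' z' => ρ z' m * (ρ x' x * ρ y' y))]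
  · simp [hX.act_mul_eq, Finset.mul_sum]
  · constructor <;> intros <;> constructor <;> intros <;> simp [mul_add, add_mul]

theorem sum_act_mul_mul (hR : IsRMatrix R) (hX : (ofAlgHom ρ).IsModuleAlgebra) (x y m : A) :
    ∑ l, ρ (𝐞 l) (x * y) * ρ (coeff l R) m =
      ∑ i, ∑ j, ρ (𝐞 j) x * (ρ (𝐞 i) y * ρ (coeff i R * coeff j R) m) := by
  rw [← hR.sum_comul_right (φ := fun x' y' z' => ρ y' x * (ρ z' y * ρ x' m))]
  · simp [hX.act_mul_eq, Finset.sum_mul, mul_assoc]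
  · constructor <;> intros <;> constructor <;> intros <;> simp [mul_add, add_mul]

/-- This is associativity of the braided opposite, (z ∘ y) ∘ x = z ∘ (y ∘ x): the hexagon identities
expand both sides into the two sides of the Yang–Baxter equation. -/
theorem sum_act_mul_act_mul (hR : IsRMatrix R) (hX : (ofAlgHom ρ).IsModuleAlgebra) (x y z : A) :
    ∑ j, ∑ l, ρ (𝐞 l) x * ρ (coeff l R) (ρ (𝐞 j) y * ρ (coeff j R) z) =
      ∑ i, ∑ l, ρ (𝐞 l) (ρ (𝐞 i) x * ρ (coeff i R) y) * ρ (coeff l R) z := by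
  have := hR.yangBaxter (φ := fun x' y' z' => ρ z' x * (ρ y' y * ρ x' z)) (by
    constructor <;> intros <;> constructor <;> intros <;> simp [mul_add, add_mul])
  simp only [sum_mul_act_mul hR hX, sum_act_mul_mul hR hX, act_act ρ]
  calc
    _ = ∑ i, ∑ j, ∑ l, ρ (𝐞 i * 𝐞 l) x * (ρ (coeff i R * 𝐞 j) y * ρ (coeff l R * coeff j R) z) :=
      Finset.sum_comm
    _ = _ := Finset.sum_congr rfl fun _ _ => Finset.sum_comm
    _ = _ := this.symm
    _ = _ := Finset.sum_congr rfl fun _ _ => Finset.sum_comm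
    _ = _ := Finset.sum_comm

/-- The braiding is H-linear: Δ^cop(h) R = R Δ(h) moves h from the left of R to its right. -/
theorem act_sum_act_mul_act (hR : IsRMatrix R) (hX : (ofAlgHom ρ).IsModuleAlgebra) (h : H)
    (x y : A) : ρ h (∑ i, ρ (𝐞 i) x * ρ (coeff i R) y) =
      ∑ i, ∑ j, ρ (𝐞 i * 𝐞 j) x * ρ (coeff i R * δ j h) y := by
  rw [← hR.sum_comul_comm (φ := fun x' y' => ρ y' x * ρ x' y), map_sum, Finset.sum_comm]
  · simp [hX.act_mul_eq]
  · intros; constructor <;> intros <;> simp [mul_add]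
  · intros; constructor <;> intros <;> simp [add_mul]

/-- `F` is multiplicative on pure tensors. -/
theorem azumayaF_smash_mul (hR : IsRMatrix R) (hX : (ofAlgHom ρ).IsModuleAlgebra)
    (a b c d m : A) :
    (ofAlgHom ρ).azumayaF R (((ofAlgHom ρ).smash R ((ofAlgHom ρ).opp R)).mul
      ((a ⊗ₜ b) ⊗ₜ (c ⊗ₜ d))) m =
      (ofAlgHom ρ).azumayaF R (a ⊗ₜ b) ((ofAlgHom ρ).azumayaF R (c ⊗ₜ d) m) := by
  have h₁ : (ofAlgHom ρ).azumayaF R (((ofAlgHom ρ).smash R ((ofAlgHom ρ).opp R)).mul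
      ((a ⊗ₜ b) ⊗ₜ (c ⊗ₜ d))) m = ∑ t, a * (ρ (𝐞 t) c * ∑ j, ∑ l, ρ (𝐞 l) m *
        ρ (coeff l R) (ρ (𝐞 j) d * ρ (coeff j R) (ρ (coeff t R) b))) := by
    simp only [smash_mul_tmul, opp_mul, ofAlgHom_mul, ofAlgHom_act, opp_act, tmul_sum, map_sum,
      LinearMap.sum_apply, azumayaF_tmul, Finset.mul_sum, mul_assoc]
  have h₂ : (ofAlgHom ρ).azumayaF R (a ⊗ₜ b) ((ofAlgHom ρ).azumayaF R (c ⊗ₜ d) m) =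
      ∑ t, a * (ρ (𝐞 t) c * ∑ i, ∑ l, ρ (𝐞 l) (ρ (𝐞 i) m * ρ (coeff i R) d) *
        ρ (coeff l R) (ρ (coeff t R) b)) := by
    simp only [azumayaF_tmul, ← Finset.mul_sum]
    rw [sum_act_mul_mul hR hX, Finset.sum_comm]
    refine congrArg (a * ·) (Finset.sum_congr rfl fun t _ => ?_)
    rw [← Finset.mul_sum, Finset.sum_comm]
    simp only [map_sum, Finset.sum_mul, map_mul, Module.End.mul_apply]
  -- With b' = R¹.b, the inner sums are (b' ∘ d) ∘ m and b' ∘ (d ∘ m).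
  rw [h₁, h₂]
  simp only [sum_act_mul_act_mul hR hX]

/-- `G` is multiplicative on pure tensors. -/
theorem azumayaG_smash_mul (hR : IsRMatrix R) (hX : (ofAlgHom ρ).IsModuleAlgebra)
    (a b c d m : A) :
    (ofAlgHom ρ).azumayaG R ((((ofAlgHom ρ).opp R).smash R (ofAlgHom ρ)).mul
      ((a ⊗ₜ b) ⊗ₜ (c ⊗ₜ d))) m =
      (ofAlgHom ρ).azumayaG R (c ⊗ₜ d) ((ofAlgHom ρ).azumayaG R (a ⊗ₜ b) m) := by
  have h₁ : (ofAlgHom ρ).azumayaG R ((((ofAlgHom ρ).opp R).smash R (ofAlgHom ρ)).mul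
      ((a ⊗ₜ b) ⊗ₜ (c ⊗ₜ d))) m = ∑ t, (∑ j, ∑ l, ρ (𝐞 l) (ρ (𝐞 j) (ρ (𝐞 t) c) *
        ρ (coeff j R) a) * ρ (coeff l R) m) * ρ (coeff t R) b * d := by
    simp only [smash_mul_tmul, opp_mul, ofAlgHom_mul, ofAlgHom_act, opp_act, sum_tmul, map_sum,
      LinearMap.sum_apply, azumayaG_tmul, Finset.sum_mul, mul_assoc]
  have h₂ : (ofAlgHom ρ).azumayaG R (c ⊗ₜ d) ((ofAlgHom ρ).azumayaG R (a ⊗ₜ b) m) =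
      ∑ t, (∑ j, ∑ l, ρ (𝐞 l) (ρ (𝐞 t) c) * ρ (coeff l R) (ρ (𝐞 j) a * ρ (coeff j R) m)) *
        ρ (coeff t R) b * d := by
    simp only [azumayaG_tmul, ← Finset.sum_mul]
    rw [sum_mul_act_mul hR hX, Finset.sum_comm]
    refine congrArg (· * d) (Finset.sum_congr rfl fun t _ => ?_)
    simp only [map_sum, Finset.sum_mul, Finset.mul_sum, map_mul, Module.End.mul_apply, mul_assoc]
    exact Finset.sum_comm
  rw [h₁, h₂]
  simp only [sum_act_mul_act_mul hR hX]

/-- `F(h₁ . x)(h₂ . c) = h . F(x)(c)`. -/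
theorem sum_azumayaF_tensorAct_act (hR : IsRMatrix R) (hX : (ofAlgHom ρ).IsModuleAlgebra) (h : H)
    (x : A ⊗[k] A) (c : A) :
    ∑ i, (ofAlgHom ρ).azumayaF R ((ofAlgHom ρ).tensorAct (ofAlgHom ρ) (δ i h) x) (ρ (𝐞 i) c) =
      ρ h ((ofAlgHom ρ).azumayaF R x c) := by
  induction x with
  | zero => simp
  | add x y hx hy => simp only [map_add, LinearMap.add_apply, Finset.sum_add_distrib, hx, hy]
  | tmul a b =>
    have := sum_coassoc (k := k) h
      (φ := fun x y z => ∑ i, ρ x a * (ρ (𝐞 i * z) c * ρ (coeff i R * y) b)) (by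
        constructor <;> intros <;> constructor <;> intros <;>
          simp [mul_add, add_mul, Finset.sum_add_distrib, Finset.smul_sum])
    simp only [tensorAct_tmul, map_sum, LinearMap.sum_apply, azumayaF_tmul, ofAlgHom_act,
      act_act ρ]
    rw [this, ← map_sum, ← Finset.mul_sum, hX.act_mul_eq]
    simp only [act_sum_act_mul_act hR hX, ← Finset.mul_sum]
    exact Finset.sum_congr rfl fun i _ => congrArg _ Finset.sum_comm

/-- `G(h₂ . x)(h₁ . c) = h . G(x)(c)`. -/
theorem sum_azumayaG_tensorAct_act (hR : IsRMatrix R) (hX : (ofAlgHom ρ).IsModuleAlgebra) (h : H)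
    (x : A ⊗[k] A) (c : A) :
    ∑ i, (ofAlgHom ρ).azumayaG R ((ofAlgHom ρ).tensorAct (ofAlgHom ρ) (𝐞 i) x) (ρ (δ i h) c) =
      ρ h ((ofAlgHom ρ).azumayaG R x c) := by
  induction x with
  | zero => simp
  | add x y hx hy => simp only [map_add, LinearMap.add_apply, Finset.sum_add_distrib, hx, hy]
  | tmul a b =>
    have := sum_coassoc (k := k) h
      (φ := fun x y z => ∑ i, ρ (𝐞 i * y) a * ρ (coeff i R * x) c * ρ z b) (by
        constructor <;> intros <;> constructor <;> intros <;>
          simp [mul_add, add_mul, Finset.sum_add_distrib, Finset.smul_sum])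
    simp only [tensorAct_tmul, map_sum, LinearMap.sum_apply, azumayaG_tmul, ofAlgHom_act,
      act_act ρ]
    rw [← this, ← map_sum, ← Finset.sum_mul, hX.act_mul_eq]
    simp only [act_sum_act_mul_act hR hX, ← Finset.sum_mul]
    exact Finset.sum_congr rfl fun i _ => congrArg (· * _) Finset.sum_comm

/-- `F` is an isomorphism of `H`-module algebras as soon as it is bijective. -/
theorem isIso_azumayaF (hR : IsRMatrix R) (hX : (ofAlgHom ρ).IsModuleAlgebra)
    (hF : Function.Bijective ((ofAlgHom ρ).azumayaF R)) :
    IsIso ((ofAlgHom ρ).smash R ((ofAlgHom ρ).opp R)) (ofAlgHom ρ).endo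
      ((ofAlgHom ρ).azumayaF R) where
  bijective := hF
  map_mul x y := by
    induction x with
    | zero => simp
    | add x x' hx hx' => simp only [add_tmul, map_add, hx, hx']
    | tmul a b =>
      induction y with
      | zero => simp
      | add y y' hy hy' => simp only [tmul_add, map_add, hy, hy']
      | tmul c d =>
        ext m
        exact azumayaF_smash_mul hR hX a b c d m
  map_one := by
    ext m
    change (ofAlgHom ρ).azumayaF R (1 ⊗ₜ 1) m = m
    have h := hX.act_one
    simp only [ofAlgHom_act, ofAlgHom_one] at h
    have := congrArg (fun x => ρ x m) hR.sum_counit_coeff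
    simpa [azumayaF_tmul, h] using this
  map_act h x := by
    ext c
    -- The element h · F(x) sends c to ∑ F(h₁.x)(h₂ S(h₃).c); coassociativity brings h₂ and S(h₃)
    -- together so that they cancel.
    have hsum := sum_coassoc (k := k) h
      (φ := fun x' y z => (ofAlgHom ρ).azumayaF R ((ofAlgHom ρ).tensorAct (ofAlgHom ρ) x' x)
        (ρ (y * S z) c)) (by
        constructor <;> intros <;> constructor <;> intros <;> simp [mul_add, add_mul])
    change (ofAlgHom ρ).azumayaF R ((ofAlgHom ρ).tensorAct (ofAlgHom ρ) h x) c = _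
    rw [endo_act_apply]
    simp only [ofAlgHom_act, ← sum_azumayaF_tensorAct_act hR hX, act_act ρ]
    rw [hsum]
    simp only [← map_sum, ← LinearMap.sum_apply, sum_mul_antipode]
    conv_lhs => rw [← sum_counit_basisVec_smul (k := k) h]
    simp only [map_sum, map_smul, map_one, LinearMap.sum_apply, LinearMap.smul_apply,
      Module.End.one_apply]

/-- `G` is an isomorphism of `H`-module algebras as soon as it is bijective. -/
theorem isIso_azumayaG (hR : IsRMatrix R) (hX : (ofAlgHom ρ).IsModuleAlgebra)
    (hG : Function.Bijective ((ofAlgHom ρ).azumayaG R)) :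
    IsIso (((ofAlgHom ρ).opp R).smash R (ofAlgHom ρ)) (ofAlgHom ρ).endoOp
      ((ofAlgHom ρ).azumayaG R) where
  bijective := hG
  map_mul x y := by
    induction x with
    | zero => simp
    | add x x' hx hx' => simp only [add_tmul, map_add, hx, hx']
    | tmul a b =>
      induction y with
      | zero => simp
      | add y y' hy hy' => simp only [tmul_add, map_add, hy, hy']
      | tmul c d =>
        ext m
        exact azumayaG_smash_mul hR hX a b c d m
  map_one := by
    ext m
    change (ofAlgHom ρ).azumayaG R (1 ⊗ₜ 1) m = m
    have h := hX.act_one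
    simp only [ofAlgHom_act, ofAlgHom_one] at h
    have := congrArg (fun x => ρ x m) hR.sum_counit_basisVec
    simpa [azumayaG_tmul, h] using this
  map_act h x := by
    ext c
    -- Here the expression is ∑ G(h₃.x)(h₂ S⁻¹(h₁).c), which is why the action on `End(A)^op` needs
    -- S⁻¹.
    have hsum := sum_coassoc (k := k) h
      (φ := fun x' y z => (ofAlgHom ρ).azumayaG R ((ofAlgHom ρ).tensorAct (ofAlgHom ρ) z x)
        (ρ (y * antipodeInv k H x') c)) (by
        constructor <;> intros <;> constructor <;> intros <;> simp [mul_add, add_mul])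
    change (ofAlgHom ρ).azumayaG R ((ofAlgHom ρ).tensorAct (ofAlgHom ρ) h x) c = _
    rw [endoOp_act_apply]
    simp only [ofAlgHom_act, ← sum_azumayaG_tensorAct_act hR hX, act_act ρ]
    rw [← hsum]
    simp only [← map_sum, ← LinearMap.sum_apply, hR.sum_mul_antipodeInv]
    conv_lhs => rw [← sum_counit_smul_basisVec (k := k) h]
    simp only [map_sum, map_smul, map_one, LinearMap.sum_apply, LinearMap.smul_apply,
      Module.End.one_apply]

end PreModuleAlgebra

end ModuleAlgebra

/-! ### The dual as a module algebra, and the map `θ` -/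

section DualModuleAlgebra

variable {k H : Type*} [Field k] [Ring H] [HopfAlgebra k H] [FiniteDimensional k H]
  {R : H ⊗[k] H}

local notation "𝐞" => basisVec k H
local notation "δ" => comulCoeff (k := k) (H := H)
local notation "ε" => Coalgebra.counit (R := k) (A := H)
local notation "S" => HopfAlgebra.antipode k (A := H)

theorem hDual_mul_apply (f g : HDual k H) (x : H) :
    (f * g).ofConv x = ∑ i, f.ofConv (δ i x) * g.ofConv (𝐞 i) := by
  rw [LinearMap.convMul_apply, comul_eq_sum]
  simp

omit [FiniteDimensional k H] in
theorem hDual_one_apply (x : H) : (1 : HDual k H).ofConv x = ε x := rfl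

/-- The coproduct of H^* is obtained by inverting the pairing H^* ⊗ H^* ≃ (H ⊗ H)^*, so it is
computed by pairing an arbitrary tensor with x ⊗ h and cancelling. -/
theorem dualAct_apply (h : H) (f : HDual k H) (x : H) :
    (dualAct k H h f).ofConv x = f.ofConv (x * h) := by
  have key (w : Module.Dual k H ⊗[k] Module.Dual k H) :
      (TensorProduct.rid k (HDual k H) ((Module.Dual.eval k H h ∘ₗ
        (WithConv.linearEquiv k (Module.Dual k H)).toLinearMap).lTensor (HDual k H)
        (TensorProduct.map (WithConv.linearEquiv k (Module.Dual k H)).symm.toLinearMap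
          (WithConv.linearEquiv k (Module.Dual k H)).symm.toLinearMap w))).ofConv x =
      TensorProduct.dualDistrib k H H w (x ⊗ₜ h) := by
    induction w with
    | zero => simp
    | add w w' hw hw' => simp only [map_add, LinearMap.add_apply, WithConv.ofConv_add, hw, hw']
    | tmul f g => simp [mul_comm]
  refine (key _).trans ?_
  change (TensorProduct.dualDistribEquiv k H H ((TensorProduct.dualDistribEquiv k H H).symm _)) _ = _
  rw [LinearEquiv.apply_symm_apply]
  simp

variable (k H) in
/-- The action of `H` on `H^*` as a representation. -/
noncomputable def dualRep : H →ₐ[k] Module.End k (HDual k H) :=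
  AlgHom.ofLinearMap (dualAct k H)
    (by ext f x; simp [dualAct_apply]) (by intro g h; ext f x; simp [dualAct_apply, mul_assoc])

theorem dualRep_apply (h : H) (f : HDual k H) (x : H) :
    (dualRep k H h f).ofConv x = f.ofConv (x * h) := dualAct_apply h f x

theorem dualModuleAlgebra_eq :
    dualModuleAlgebra k H = PreModuleAlgebra.ofAlgHom (dualRep k H) := rfl

theorem isModuleAlgebra_dualRep :
    (PreModuleAlgebra.ofAlgHom (dualRep k H)).IsModuleAlgebra := by
  apply PreModuleAlgebra.isModuleAlgebra_ofAlgHom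
  · intro h f g
    ext x
    simp only [WithConv.ofConv_sum, LinearMap.sum_apply, hDual_mul_apply, dualRep_apply]
    rw [sum_comul_mul (φ := fun y z => f.ofConv y * g.ofConv z), Finset.sum_comm]
    · intros; constructor <;> intros <;> simp [add_mul, mul_assoc]
    · intros; constructor <;> intros <;> simp [mul_add, mul_left_comm]
  · intro h
    ext x
    simp [dualRep_apply, mul_comm]

/-- The linear map underlying `θ`. -/
noncomputable def thetaLinear (R : H ⊗[k] H) : Module.Dual k H →ₗ[k] H :=
  ∑ i, (Module.Dual.eval k H (𝐞 i)).smulRight (coeff i R)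

/-- `f ↦ ∑ ⟨f, R¹⟩ R²`, the transpose of `θ`. -/
noncomputable def thetaTranspose (R : H ⊗[k] H) : Module.Dual k H →ₗ[k] H :=
  ∑ i, (Module.Dual.eval k H (coeff i R)).smulRight (𝐞 i)

theorem thetaLinear_apply (f : Module.Dual k H) :
    thetaLinear R f = ∑ i, f (𝐞 i) • coeff i R := by
  simp [thetaLinear]

theorem thetaTranspose_apply (f : Module.Dual k H) :
    thetaTranspose R f = ∑ i, f (coeff i R) • 𝐞 i := by
  simp [thetaTranspose]

theorem apply_thetaTranspose (f g : Module.Dual k H) :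
    f (thetaTranspose R g) = g (thetaLinear R f) := by
  simp [thetaLinear_apply, thetaTranspose_apply, mul_comm]

/-- Surjectivity of a map makes its transpose injective, and H^* and H have equal dimension. -/
theorem bijective_of_transpose {φ ψ : Module.Dual k H →ₗ[k] H}
    (h : ∀ f g : Module.Dual k H, f (φ g) = g (ψ f)) (hφ : Function.Surjective φ) :
    Function.Bijective ψ := by
  have hinj : Function.Injective ψ := by
    rw [injective_iff_map_eq_zero]
    intro f hf
    ext x
    obtain ⟨g, rfl⟩ := hφ x
    rw [h, hf, map_zero, LinearMap.zero_apply]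
  exact ⟨hinj, (LinearMap.injective_iff_surjective_of_finrank_eq_finrank
    Subspace.dual_finrank_eq).mp hinj⟩

theorem theta_eq (f : (HDual k H)ᵐᵒᵖ) : theta R f = thetaLinear R f.unop.ofConv := by
  rw [thetaLinear_apply, theta]
  conv_lhs => enter [2, 2]; rw [← sum_coeff_tmul R]
  simp

variable (R) in
/-- `θ` as an algebra homomorphism. -/
noncomputable def thetaAlgHom (hR : IsRMatrix R) : (HDual k H)ᵐᵒᵖ →ₐ[k] H :=
  AlgHom.ofLinearMap (thetaLinear R ∘ₗ (WithConv.linearEquiv k (Module.Dual k H)).toLinearMap ∘ₗ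
      (MulOpposite.opLinearEquiv k).symm.toLinearMap)
    (by simpa [thetaLinear_apply, hDual_one_apply] using hR.sum_counit_basisVec)
    (by
      intro f g
      -- The order of the factors in (id ⊗ Δ)(R) = R₁₃R₁₂ is what forces the opposite product on
      -- H^*.
      have := hR.sum_comul_right
        (φ := fun x y z => (g.unop.ofConv y * f.unop.ofConv z) • x) (by
          constructor <;> intros <;> constructor <;> intros <;>
            (try simp [mul_add, add_mul, add_smul]) <;> module)
      change thetaLinear R (g.unop * f.unop).ofConv =
        thetaLinear R f.unop.ofConv * thetaLinear R g.unop.ofConv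
      rw [thetaLinear_apply]
      simp only [hDual_mul_apply, Finset.sum_smul, this]
      simp only [thetaLinear_apply, Finset.sum_mul_sum, smul_mul_smul_comm, mul_comm])

theorem thetaAlgHom_apply (hR : IsRMatrix R) (f : (HDual k H)ᵐᵒᵖ) :
    thetaAlgHom R hR f = thetaLinear R f.unop.ofConv := rfl

theorem counit_thetaLinear (hR : IsRMatrix R) (f : Module.Dual k H) :
    ε (thetaLinear R f) = f 1 := by
  simp [thetaLinear_apply, ← hR.sum_counit_coeff, mul_comm]

/-- By (Δ ⊗ id)(R) = R₁₃R₂₃, both sides equal ∑ ⟨f, R²R'²⟩ R¹ ⊗ R'¹, where R' is a second copy of R.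
-/
theorem map_thetaAlgHom_comul (hR : IsRMatrix R) (f : (HDual k H)ᵐᵒᵖ) :
    TensorProduct.map (thetaAlgHom R hR).toLinearMap (thetaAlgHom R hR).toLinearMap
      (Coalgebra.comul (R := k) f) = Coalgebra.comul (R := k) (thetaAlgHom R hR f) := by
  have key (w : Module.Dual k H ⊗[k] Module.Dual k H) :
      TensorProduct.map (thetaLinear R) (thetaLinear R) w =
        ∑ i, ∑ j, TensorProduct.dualDistrib k H H w (𝐞 i ⊗ₜ 𝐞 j) • (coeff i R ⊗ₜ coeff j R) := by
    induction w with
    | zero => simp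
    | add w w' hw hw' =>
      simp only [map_add, LinearMap.add_apply, add_smul, Finset.sum_add_distrib, hw, hw']
    | tmul f g =>
      simp only [thetaLinear_apply, TensorProduct.map_tmul, sum_tmul, tmul_sum, smul_tmul_smul,
        TensorProduct.dualDistrib_apply]
      exact Finset.sum_comm
  have h₁ := hR.sum_comul_left (φ := fun x y z => f.unop.ofConv z • (x ⊗ₜ[k] y)) (by
    constructor <;> intros <;> constructor <;> intros <;>
      simp [tmul_add, add_tmul, ← smul_tmul', add_smul] <;> module)
  have h₂ : TensorProduct.map (thetaAlgHom R hR).toLinearMap (thetaAlgHom R hR).toLinearMap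
      (Coalgebra.comul (R := k) f) = TensorProduct.map (thetaLinear R) (thetaLinear R)
        ((TensorProduct.dualDistribEquiv k H H).symm
          ((LinearMap.mul' k H).dualMap f.unop.ofConv)) := by
    change TensorProduct.map _ _ (TensorProduct.map _ _ (TensorProduct.map _ _ _)) = _
    rw [TensorProduct.map_map, TensorProduct.map_map]
    rfl
  rw [h₂, key, thetaAlgHom_apply, thetaLinear_apply]
  simp only [map_sum, map_smul, comul_eq_sum, Finset.smul_sum, h₁]
  refine Finset.sum_congr rfl fun i _ => Finset.sum_congr rfl fun j _ => ?_
  congr 1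
  change (TensorProduct.dualDistribEquiv k H H ((TensorProduct.dualDistribEquiv k H H).symm _)) _ = _
  rw [LinearEquiv.apply_symm_apply]
  simp

/-- `θ` underlies an isomorphism of bialgebras precisely when it is bijective. -/
theorem exists_bialgEquiv_iff (hR : IsRMatrix R) :
    (∃ e : (HDual k H)ᵐᵒᵖ ≃ₐc[k] H, ∀ f, e f = theta R f) ↔
      Function.Bijective (thetaLinear R) := by
  have hθ : ⇑(thetaAlgHom R hR) = thetaLinear R ∘
      ((MulOpposite.opEquiv (α := HDual k H)).symm.trans (WithConv.equiv (Module.Dual k H))) := rfl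
  constructor
  · rintro ⟨e, he⟩
    rw [← Equiv.bijective_comp ((MulOpposite.opEquiv (α := HDual k H)).symm.trans
      (WithConv.equiv (Module.Dual k H))), ← hθ]
    convert e.toEquiv.bijective using 1
    ext f
    exact (theta_eq f).symm.trans (he f).symm
  · intro h
    have hb : Function.Bijective (thetaAlgHom R hR) := hθ ▸ h.comp (Equiv.bijective _)
    refine ⟨{ AlgEquiv.ofBijective (thetaAlgHom R hR) hb with
      map_smul' := map_smul (thetaAlgHom R hR)
      counit_comp := LinearMap.ext fun f => counit_thetaLinear hR _
      map_comp_comul := LinearMap.ext fun f => map_thetaAlgHom_comul hR f },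
      fun f => (theta_eq f).symm⟩

end DualModuleAlgebra

/-! ### Bijectivity of `F` and `G` for the dual -/

section Bijectivity

variable {k H : Type*} [Field k] [Ring H] [HopfAlgebra k H] [FiniteDimensional k H]
  {R : H ⊗[k] H}

local notation "𝐞" => basisVec k H
local notation "δ" => comulCoeff (k := k) (H := H)
local notation "ε" => Coalgebra.counit (R := k) (A := H)
local notation "S" => HopfAlgebra.antipode k (A := H)

variable {M : Type*} [AddCommGroup M] [Module k M]

/-- For a right action `r` of `H` on `M`, the twist `f ↦ (x ↦ ∑ f(x₁) . T(x₂))` of `Hom(H, M)`. -/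
noncomputable def twistLeft (r : H →ₗ[k] Module.End k M) (T : H →ₗ[k] H) :
    Module.End k (H →ₗ[k] M) where
  toFun f := ∑ i, r (T (𝐞 i)) ∘ₗ f ∘ₗ δ i
  map_add' f g := by ext; simp [Finset.sum_add_distrib]
  map_smul' c f := by ext; simp [Finset.smul_sum]

/-- For a right action `r` of `H` on `M`, the twist `f ↦ (x ↦ ∑ f(x₂) . T(x₁))` of `Hom(H, M)`. -/
noncomputable def twistRight (r : H →ₗ[k] Module.End k M) (T : H →ₗ[k] H) :
    Module.End k (H →ₗ[k] M) where
  toFun f := ∑ i, (r.flip (f (𝐞 i))) ∘ₗ T ∘ₗ δ i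
  map_add' f g := by ext; simp [Finset.sum_add_distrib]
  map_smul' c f := by ext; simp [Finset.smul_sum]

theorem twistLeft_apply (r : H →ₗ[k] Module.End k M) (T : H →ₗ[k] H) (f : H →ₗ[k] M) (x : H) :
    twistLeft r T f x = ∑ i, r (T (𝐞 i)) (f (δ i x)) := by
  simp [twistLeft]

theorem twistRight_apply (r : H →ₗ[k] Module.End k M) (T : H →ₗ[k] H) (f : H →ₗ[k] M) (x : H) :
    twistRight r T f x = ∑ i, r (T (δ i x)) (f (𝐞 i)) := by
  simp [twistRight]

/-- Twists compose by convolution, so it suffices that T' is a convolution inverse of T in the sense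
of `hT`. The product `m` is the one for which `r` is multiplicative: opposite for right
multiplication on H, the original one for the action on the dual. -/
theorem twistLeft_twistLeft {r : H →ₗ[k] Module.End k M} {T T' : H →ₗ[k] H}
    {m : H →ₗ[k] H →ₗ[k] H} (hr : ∀ g h, r g * r h = r (m g h)) (hr₁ : r 1 = 1)
    (hT : ∀ x, ∑ i, m (T (𝐞 i)) (T' (δ i x)) = ε x • (1 : H)) (f : H →ₗ[k] M) :
    twistLeft r T (twistLeft r T' f) = f := by
  ext x
  have := sum_coassoc (k := k) x (φ := fun x y z => r (m (T z) (T' y)) (f x)) (by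
    constructor <;> intros <;> constructor <;> intros <;> simp)
  have hr' (g h v) : r g (r h v) = r (m g h) v := LinearMap.congr_fun (hr g h) v
  simp only [twistLeft_apply, map_sum, hr', this]
  simp only [← map_sum, ← LinearMap.sum_apply, hT]
  conv_rhs => rw [← sum_counit_basisVec_smul (k := k) x]
  simp [hr₁]

theorem twistRight_twistRight {r : H →ₗ[k] Module.End k M} {T T' : H →ₗ[k] H}
    {m : H →ₗ[k] H →ₗ[k] H} (hr : ∀ g h, r g * r h = r (m g h)) (hr₁ : r 1 = 1)
    (hT : ∀ x, ∑ i, m (T (δ i x)) (T' (𝐞 i)) = ε x • (1 : H)) (f : H →ₗ[k] M) :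
    twistRight r T (twistRight r T' f) = f := by
  ext x
  have := sum_coassoc (k := k) x (φ := fun x y z => r (m (T x) (T' y)) (f z)) (by
    constructor <;> intros <;> constructor <;> intros <;> simp)
  have hr' (g h v) : r g (r h v) = r (m g h) v := LinearMap.congr_fun (hr g h) v
  simp only [twistRight_apply, map_sum, hr', ← this]
  simp only [← map_sum, ← LinearMap.sum_apply, hT]
  conv_rhs => rw [← sum_counit_smul_basisVec (k := k) x]
  simp [hr₁]

variable (k H) in
/-- The right action of `H` on itself by right multiplication. -/
noncomputable def rightMul : H →ₗ[k] Module.End k H := (LinearMap.mul k H).flip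

variable (k H) in
/-- The action `(h . f)(y) = f(y h)` of `H` on its dual. -/
noncomputable def rightMulDual : H →ₗ[k] Module.End k (Module.Dual k H) :=
  Module.Dual.transpose (R := k) ∘ₗ rightMul k H

omit [FiniteDimensional k H] in
theorem rightMul_apply (h x : H) : rightMul k H h x = x * h := rfl

omit [FiniteDimensional k H] in
theorem rightMulDual_apply (h : H) (f : Module.Dual k H) (x : H) :
    rightMulDual k H h f x = f (x * h) := rfl

omit [FiniteDimensional k H] in
theorem rightMul_mul (g h : H) :
    rightMul k H g * rightMul k H h = rightMul k H ((LinearMap.mul k H).flip g h) := by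
  ext x
  simp [rightMul_apply, mul_assoc]

omit [FiniteDimensional k H] in
theorem rightMulDual_mul (g h : H) :
    rightMulDual k H g * rightMulDual k H h = rightMulDual k H (LinearMap.mul k H g h) := by
  ext f x
  simp [rightMulDual_apply, mul_assoc]

omit [FiniteDimensional k H] in
theorem rightMul_one : rightMul k H 1 = 1 := by
  ext x
  simp [rightMul_apply]

omit [FiniteDimensional k H] in
theorem rightMulDual_one : rightMulDual k H 1 = 1 := by
  ext x
  simp [rightMulDual_apply]

theorem bijective_of_rightInverse {V : Type*} [AddCommGroup V] [Module k V]
    [FiniteDimensional k V] {f g : Module.End k V} (h : ∀ x, f (g x) = x) :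
    Function.Bijective f := by
  have hs : Function.Surjective f := fun x => ⟨g x, h x⟩
  exact ⟨LinearMap.injective_iff_surjective.mpr hs, hs⟩

theorem bijective_twistLeft_rightMul :
    Function.Bijective (twistLeft (rightMul k H) LinearMap.id) :=
  bijective_of_rightInverse (twistLeft_twistLeft rightMul_mul rightMul_one
    (T' := S) (by simp [sum_antipode_mul]))

theorem bijective_twistRight_rightMul (hR : IsRMatrix R) :
    Function.Bijective (twistRight (rightMul k H) LinearMap.id) :=
  bijective_of_rightInverse (twistRight_twistRight rightMul_mul rightMul_one
    (T' := antipodeInv k H) (by simp [hR.sum_antipodeInv_mul]))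

theorem bijective_twistLeft_rightMulDual (hR : IsRMatrix R) :
    Function.Bijective (twistLeft (rightMulDual k H) LinearMap.id) :=
  bijective_of_rightInverse (twistLeft_twistLeft rightMulDual_mul rightMulDual_one
    (T' := antipodeInv k H) (by simp [hR.sum_mul_antipodeInv]))

theorem bijective_twistRight_rightMulDual :
    Function.Bijective (twistRight (rightMulDual k H) LinearMap.id) :=
  bijective_of_rightInverse (twistRight_twistRight rightMulDual_mul rightMulDual_one
    (T' := S) (by simp [sum_mul_antipode]))

variable (k H) in
/-- `f ↦ f^*`, as an equivalence from `End(H)` to `End(H^*)`. -/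
noncomputable def transposeEquiv : Module.End k H ≃ Module.End k (HDual k H) where
  toFun f := (WithConv.linearEquiv k (Module.Dual k H)).symm.toLinearMap ∘ₗ f.dualMap ∘ₗ
    (WithConv.linearEquiv k (Module.Dual k H)).toLinearMap
  invFun g := (Module.evalEquiv k H).symm.toLinearMap ∘ₗ
    ((WithConv.linearEquiv k (Module.Dual k H)).toLinearMap ∘ₗ g ∘ₗ
      (WithConv.linearEquiv k (Module.Dual k H)).symm.toLinearMap).dualMap ∘ₗ
    (Module.evalEquiv k H).toLinearMap
  left_inv f := by
    ext x
    apply (Module.evalEquiv k H).injective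
    ext φ
    simp
  right_inv g := by
    ext φ x
    simp

theorem transposeEquiv_apply (f : Module.End k H) (φ : HDual k H) (x : H) :
    (transposeEquiv k H f φ).ofConv x = φ.ofConv (f x) := rfl

variable (k H) in
/-- `H^* ⊗ H^* ≃ Hom(H, H^*)`, `a ⊗ b ↦ (x ↦ a(x) b)`. -/
noncomputable def tensorEquivHom :
    HDual k H ⊗[k] HDual k H ≃ₗ[k] (H →ₗ[k] Module.Dual k H) :=
  TensorProduct.congr (WithConv.linearEquiv k _) (WithConv.linearEquiv k _) ≪≫ₗ
    dualTensorHomEquiv k H (Module.Dual k H)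

theorem tensorEquivHom_tmul (a b : HDual k H) (x : H) :
    tensorEquivHom k H (a ⊗ₜ b) x = a.ofConv x • b.ofConv := by
  simp [tensorEquivHom]

/-- On a ⊗ b the nested maps produce successively a(x₁) b(· x₂), then a(x₁) b(R¹ x₂) R², then a(x₁)
b(R¹ x₂) R² x₃. The definition of F gives a(x₁) c(x₂ R²) b(x₃ R¹) instead, and Δ^cop(h) R = R Δ(h)
reconciles the two. -/
theorem azumayaF_dual_eq (hR : IsRMatrix R) (z : HDual k H ⊗[k] HDual k H) :
    (PreModuleAlgebra.ofAlgHom (dualRep k H)).azumayaF R z = transposeEquiv k H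
      (twistLeft (rightMul k H) LinearMap.id (thetaTranspose R ∘ₗ
        twistLeft (rightMulDual k H) LinearMap.id (tensorEquivHom k H z))) := by
  induction z with
  | zero =>
    ext c x
    simp [transposeEquiv_apply]
  | add z w hz hw =>
    rw [map_add, hz, hw]
    ext c x
    simp [transposeEquiv_apply, LinearMap.comp_add]
  | tmul a b =>
    ext c x
    have h₁ := sum_coassoc (k := k) x
      (φ := fun x y z => a.ofConv x * ∑ l, c.ofConv (𝐞 l * z) * b.ofConv (coeff l R * y)) (by
        constructor <;> intros <;> constructor <;> intros <;>
          simp [mul_add, add_mul, Finset.sum_add_distrib, Finset.mul_sum, mul_assoc,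
            mul_left_comm])
    have h₂ (i) := hR.sum_comul_comm (𝐞 i) (φ := fun x y => c.ofConv y * b.ofConv x)
      (by intros; constructor <;> intros <;> simp [mul_add, mul_left_comm])
      (by intros; constructor <;> intros <;> simp [add_mul, mul_assoc])
    have hl : ((PreModuleAlgebra.ofAlgHom (dualRep k H)).azumayaF R (a ⊗ₜ b) c).ofConv x =
        ∑ i, a.ofConv (δ i x) * ∑ l, ∑ j,
          c.ofConv (δ j (𝐞 i) * 𝐞 l) * b.ofConv (𝐞 j * coeff l R) := by
      simp only [PreModuleAlgebra.azumayaF_tmul, ← Finset.mul_sum, hDual_mul_apply,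
        WithConv.ofConv_sum, LinearMap.sum_apply, dualRep_apply]
    have hr : ∑ i, a.ofConv (δ i x) * ∑ l, ∑ j,
          c.ofConv (δ j (𝐞 i) * 𝐞 l) * b.ofConv (𝐞 j * coeff l R) =
        ∑ i, ∑ j, a.ofConv (δ i x) * ∑ l,
          c.ofConv (𝐞 l * 𝐞 j) * b.ofConv (coeff l R * δ j (𝐞 i)) := by
      refine Finset.sum_congr rfl fun i _ => ?_
      rw [Finset.sum_comm, h₂, Finset.sum_comm, Finset.mul_sum]
    rw [hl, hr, ← h₁, transposeEquiv_apply]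
    simp only [twistLeft_apply, LinearMap.comp_apply, LinearMap.id_apply, tensorEquivHom_tmul,
      map_sum, map_smul, rightMul_apply, thetaTranspose_apply, rightMulDual_apply,
      Finset.smul_sum, smul_eq_mul, Finset.mul_sum,
      mul_comm (b.ofConv _)]

/-- The mirror image: G(a # b) is dual to x ↦ ∑ b(x₃) a(R² x₂) R¹ x₁. Here b is the factor evaluated
first, hence the flip of z. -/
theorem azumayaG_dual_eq (hR : IsRMatrix R) (z : HDual k H ⊗[k] HDual k H) :
    (PreModuleAlgebra.ofAlgHom (dualRep k H)).azumayaG R z = transposeEquiv k H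
      (twistRight (rightMul k H) LinearMap.id (thetaLinear R ∘ₗ
        twistRight (rightMulDual k H) LinearMap.id
          (tensorEquivHom k H (TensorProduct.comm k _ _ z)))) := by
  induction z with
  | zero =>
    ext c x
    simp [transposeEquiv_apply]
  | add z w hz hw =>
    rw [map_add, hz, hw]
    ext c x
    simp [transposeEquiv_apply, LinearMap.comp_add]
  | tmul a b =>
    ext c x
    have h₁ := sum_coassoc (k := k) x
      (φ := fun x y z => (∑ l, a.ofConv (𝐞 l * y) * c.ofConv (coeff l R * x)) * b.ofConv z) (by
        constructor <;> intros <;> constructor <;> intros <;>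
          simp [mul_add, add_mul, Finset.sum_add_distrib, Finset.mul_sum, Finset.sum_mul, mul_assoc,
            mul_left_comm])
    have h₂ (i) := hR.sum_comul_comm (δ i x) (φ := fun x y => a.ofConv y * c.ofConv x)
      (by intros; constructor <;> intros <;> simp [mul_add, mul_left_comm])
      (by intros; constructor <;> intros <;> simp [add_mul, mul_assoc])
    have hl : ((PreModuleAlgebra.ofAlgHom (dualRep k H)).azumayaG R (a ⊗ₜ b) c).ofConv x =
        ∑ i, (∑ l, ∑ j, a.ofConv (δ j (δ i x) * 𝐞 l) * c.ofConv (𝐞 j * coeff l R)) *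
          b.ofConv (𝐞 i) := by
      simp only [PreModuleAlgebra.azumayaG_tmul, ← Finset.sum_mul, hDual_mul_apply,
        WithConv.ofConv_sum, LinearMap.sum_apply, dualRep_apply]
    have hr : ∑ i, (∑ l, ∑ j, a.ofConv (δ j (δ i x) * 𝐞 l) * c.ofConv (𝐞 j * coeff l R)) *
          b.ofConv (𝐞 i) =
        ∑ i, ∑ j, (∑ l, a.ofConv (𝐞 l * 𝐞 j) * c.ofConv (coeff l R * δ j (δ i x))) *
          b.ofConv (𝐞 i) := by
      refine Finset.sum_congr rfl fun i _ => ?_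
      rw [Finset.sum_comm, h₂, Finset.sum_comm, Finset.sum_mul]
    rw [hl, hr, h₁, transposeEquiv_apply]
    simp only [twistRight_apply, LinearMap.comp_apply, LinearMap.id_apply, tensorEquivHom_tmul,
      TensorProduct.comm_tmul, map_sum, map_smul, rightMul_apply, thetaLinear_apply,
      rightMulDual_apply, Finset.smul_sum, Finset.sum_mul, smul_eq_mul, mul_comm (b.ofConv _)]

omit [FiniteDimensional k H] in
theorem bijective_comp_left {φ : Module.Dual k H →ₗ[k] H} (hφ : Function.Bijective φ) :
    Function.Bijective fun f : H →ₗ[k] Module.Dual k H => φ ∘ₗ f :=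
  (LinearEquiv.congrRight (M := H) (LinearEquiv.ofBijective φ hφ)).bijective

omit [FiniteDimensional k H] in
theorem surjective_of_surjective_comp_left {φ : Module.Dual k H →ₗ[k] H}
    (h : Function.Surjective fun f : H →ₗ[k] Module.Dual k H => φ ∘ₗ f) :
    Function.Surjective φ := by
  intro y
  -- To reach y, lift the map x ↦ ε(x) y and evaluate the lift at 1.
  obtain ⟨f, hf⟩ := h ((Coalgebra.counit (R := k) (A := H)).smulRight y)
  exact ⟨f 1, by simpa using LinearMap.congr_fun hf 1⟩

theorem bijective_azumayaF_dual_iff (hR : IsRMatrix R) :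
    Function.Bijective ((PreModuleAlgebra.ofAlgHom (dualRep k H)).azumayaF R) ↔
      Function.Bijective fun f : H →ₗ[k] Module.Dual k H => thetaTranspose R ∘ₗ f := by
  have h : ⇑((PreModuleAlgebra.ofAlgHom (dualRep k H)).azumayaF R) = transposeEquiv k H ∘
      Equiv.ofBijective _ (bijective_twistLeft_rightMul (k := k) (H := H)) ∘
      (fun f : H →ₗ[k] Module.Dual k H => thetaTranspose R ∘ₗ f) ∘
      (tensorEquivHom k H).toEquiv.trans
        (Equiv.ofBijective _ (bijective_twistLeft_rightMulDual hR)) :=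
    funext fun z => azumayaF_dual_eq hR z
  rw [h, Equiv.comp_bijective, Equiv.comp_bijective, Equiv.bijective_comp]

theorem bijective_azumayaG_dual_iff (hR : IsRMatrix R) :
    Function.Bijective ((PreModuleAlgebra.ofAlgHom (dualRep k H)).azumayaG R) ↔
      Function.Bijective fun f : H →ₗ[k] Module.Dual k H => thetaLinear R ∘ₗ f := by
  have h : ⇑((PreModuleAlgebra.ofAlgHom (dualRep k H)).azumayaG R) = transposeEquiv k H ∘
      Equiv.ofBijective _ (bijective_twistRight_rightMul hR) ∘
      (fun f : H →ₗ[k] Module.Dual k H => thetaLinear R ∘ₗ f) ∘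
      ((TensorProduct.comm k _ _).toEquiv.trans (tensorEquivHom k H).toEquiv).trans
        (Equiv.ofBijective _ (bijective_twistRight_rightMulDual (k := k) (H := H))) :=
    funext fun z => azumayaG_dual_eq hR z
  rw [h, Equiv.comp_bijective, Equiv.comp_bijective, Equiv.bijective_comp]

end Bijectivity

end QuasitriangularAzumaya

theorem corollary2p7 {k H : Type*} [Field k] [Ring H] [HopfAlgebra k H] [FiniteDimensional k H]
    (R : H ⊗[k] H) (hR : QuasitriangularAzumaya.IsRMatrix R) :
    (QuasitriangularAzumaya.dualModuleAlgebra k H).IsAzumaya R ↔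
      ∃ e : (QuasitriangularAzumaya.HDual k H)ᵐᵒᵖ ≃ₐc[k] H,
        ∀ f, e f = QuasitriangularAzumaya.theta R f := by
  open QuasitriangularAzumaya in
  rw [exists_bialgEquiv_iff hR, dualModuleAlgebra_eq]
  constructor
  · intro h
    -- Bijectivity of F suffices here: it makes θᵗ surjective, hence θ bijective.
    have hs := surjective_of_surjective_comp_left
      ((bijective_azumayaF_dual_iff hR).mp h.isIso_F.bijective).surjective
    exact bijective_of_transpose apply_thetaTranspose hs
  · intro h
    have h' : Function.Bijective (thetaTranspose R) :=
      bijective_of_transpose (fun f g => (apply_thetaTranspose g f).symm) h.surjective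
    exact
      { finite := Module.Finite.equiv (WithConv.linearEquiv k (Module.Dual k H)).symm
        isModuleAlgebra := isModuleAlgebra_dualRep
        isIso_F := PreModuleAlgebra.isIso_azumayaF hR isModuleAlgebra_dualRep
          ((bijective_azumayaF_dual_iff hR).mpr (bijective_comp_left h'))
        isIso_G := PreModuleAlgebra.isIso_azumayaG hR isModuleAlgebra_dualRep
          ((bijective_azumayaG_dual_iff hR).mpr (bijective_comp_left h)) }
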